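/- **Definitions.** A metric space $Z$ is *Ahlfors regular* if for some $Q>0$ there are $c,C>0$ with $c\,r^Q\le \mathcal H^Q(B(x,r))\le C\,r^Q$ for all $x\in Z$ and all $0<r\le \operatorname{diam} Z$, where $\mathcal H^Q$ is the $Q$-dimensional Hausdorff measure. A homeomorphism $f:Z\to W$ of metric spaces is a *quasisymmetry* if there is a homeomorphism $\eta:[0,\infty)\to[0,\infty)$ with $\frac{d_W(f(x),f(y))}{d_W(f(x),f(z))}\le\eta\!\left(\frac{d_Z(x,y)}{d_Z(x,z)}\right)$ for all $x,y,z\in Z$ with $x\ne z$; $Z$ and $W$ are *quasisymmetrically equivalent* if there is a quasisymmetry from $Z$ onto $W$. Two metric spaces $X,Y$ are *bilipschitz equivalent* if there are a bijection $f:X\to Y$ and $C>0$ with $\frac1C d_X(x,x')\le d_Y(f(x),f(x'))\le C\,d_X(x,x')$ for all $x,x'\in X$. A *hyperbolic filling* of a compact metric space $Z$ is a graph built as follows. Choose $R>0$, $s>1$, $\delta>0$ and put $r_n=R s^{-n}$ for $n=0,1,2,\dots$. For each $n$ choose a set $P_n\subset Z$ whose distinct points have mutual distance at least $\delta r_n$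 and such that every point of $Z$ is at distance less than $r_n$ from $P_n$ (for instance, with $\delta=1$, a maximal $r_n$-separated set), where $P_0$ consists of a single point. The vertex set is the disjoint union of the levels $P_n$. Choose $\lambda>1$ and $\tau\ge1$. Two distinct vertices $p,q$ of the same level $n$ are joined by an edge if and only if the balls $B(p,\lambda r_n)$ and $B(q,\lambda r_n)$ intersect. Vertices $p$ of level $n$ and $q$ of level $n+1$ are joined if and only if, according to a convention fixed for the whole graph, either (a) the balls $B(p,\tau r_n)$ and $B(q,\tau r_{n+1})$ intersect, or (b) $B(q,\tau r_{n+1})\subseteq B(p,\tau r_n)$, where in case (b) it is required that $1+\frac{1+\tau}{s}\le\tau$ (for instance $\tau=2$, $s\ge6$). There are no other edges. The balls may be taken open or closed, independently for the edges within a level and for those between levels, but fixed for the whole graph. Such a graph is connected, and its vertex set carries the graph metric (the least number of edges of a path joining two vertices). **Corollary.** Let $Z$ and $W$ be compact, Ahlfors regular metric spaces. 1. If $Z$ and $W$ are quasisymmetrically equivalent, then for every hyperbolic filling $X=(V_X,E_X)$ of $Z$ and every hyperbolic filling $Y=(V_Y,E_Y)$ of $W$, the vertex sets $V_X$ and $V_Y$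 with their graph metrics are bilipschitz equivalent. 2. In particular, for any two hyperbolic fillings $X,X'$ of $Z$, the vertex sets $V_X$ and $V_{X'}$ are bilipschitz equivalent. -/

import Mathlib

open MeasureTheory
open scoped NNReal ENNReal

/-- `Z` is Ahlfors `Q`-regular for some exponent `Q > 0`: with `μH[Q]` the `Q`-dimensional
Hausdorff measure, `c r ^ Q ≤ μH[Q] (B(x, r)) ≤ C r ^ Q` for all `x` and `0 < r ≤ diam Z`. -/
def IsAhlforsRegular (Z : Type*) [MetricSpace Z] [MeasurableSpace Z] [BorelSpace Z] : Prop :=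
  ∃ Q : ℝ, 0 < Q ∧ ∃ c C : ℝ, 0 < c ∧ 0 < C ∧
    ∀ (x : Z) (r : ℝ), 0 < r → r ≤ Metric.diam (Set.univ : Set Z) →
      ENNReal.ofReal (c * r ^ Q) ≤ Measure.hausdorffMeasure Q (Metric.ball x r) ∧
      Measure.hausdorffMeasure Q (Metric.ball x r) ≤ ENNReal.ofReal (C * r ^ Q)

/-- A homeomorphism `f` is a quasisymmetry if there is a homeomorphism
`η : [0, ∞) → [0, ∞)` controlling all ratios of distances. -/
def IsQuasisymmetry {Z W : Type*} [MetricSpace Z] [MetricSpace W] (f : Z ≃ₜ W) : Prop :=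
  ∃ η : ℝ≥0 ≃ₜ ℝ≥0, ∀ x y z : Z, x ≠ z →
    nndist (f x) (f y) / nndist (f x) (f z) ≤ η (nndist x y / nndist x z)

/-- There is a quasisymmetry from `Z` onto `W`. -/
def QuasisymmetricallyEquivalent (Z W : Type*) [MetricSpace Z] [MetricSpace W] : Prop :=
  ∃ f : Z ≃ₜ W, IsQuasisymmetry f

/-- There is a bijection that distorts distances by at most a multiplicative constant. -/
def BilipschitzEquivalent (X Y : Type*) [MetricSpace X] [MetricSpace Y] : Prop :=
  ∃ f : X → Y, Function.Bijective f ∧ ∃ C : ℝ, 0 < C ∧ ∀ x x' : X,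
    (1 / C) * dist x x' ≤ dist (f x) (f x') ∧ dist (f x) (f x') ≤ C * dist x x'

/-- Constructions of hyperbolic fillings in the literature use open or closed balls. -/
inductive BallKind
  | openBalls
  | closedBalls

/-- The ball with given centre and radius, open or closed. -/
def BallKind.ball {Z : Type*} [MetricSpace Z] : BallKind → Z → ℝ → Set Z
  | .openBalls => Metric.ball
  | .closedBalls => Metric.closedBall

/-- Constructions of hyperbolic fillings in the literature join vertices of consecutive levels
either if their balls overlap or if the smaller ball is contained in the larger one. -/
inductive VerticalRule
  | overlap
  | containment

/-- The condition on the ball `A` of level `n` and the ball `B` of level `n + 1`. -/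
def VerticalRule.holds {Z : Type*} : VerticalRule → Set Z → Set Z → Prop
  | .overlap, A, B => (A ∩ B).Nonempty
  | .containment, A, B => B ⊆ A

/-- The data of a (rooted) hyperbolic filling of a bounded metric space `Z`.

With `r n = scale / ratio ^ n`, level `n` consists of the points of a `sep * r n`-separated subset
`net n` of `Z` whose open `r n`-balls cover `Z` (so every maximal `r n`-separated set is allowed,
with `sep = 1`); level `0` has a single vertex, the root.  The vertex given by `p ∈ net n` stands
for balls centred at `p` whose radii are fixed multiples of `r n`.  Two vertices of the same level
are joined if their balls overlap; two vertices of consecutive levels are joined if their balls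
overlap or, in the other usual convention, if the smaller ball is contained in the larger one. -/
structure HyperbolicFilling (Z : Type*) [MetricSpace Z] where
  /-- the radius at level `0` -/
  scale : ℝ
  scale_pos : 0 < scale
  /-- the factor between the radii of consecutive levels -/
  ratio : ℝ
  one_lt_ratio : 1 < ratio
  /-- the separation constant -/
  sep : ℝ
  sep_pos : 0 < sep
  /-- the centres of the balls of level `n` -/
  net : ℕ → Set Z
  net_zero : ∃ p : Z, net 0 = {p}
  separated : ∀ n, (net n).Pairwise fun p q => sep * (scale / ratio ^ n) ≤ dist p q
  covers : ∀ (n : ℕ) (z : Z), ∃ p ∈ net n, dist z p < scale / ratio ^ n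
  /-- open or closed balls, for edges within one level -/
  hKind : BallKind
  /-- the multiple of `r n` that is the radius, for edges within one level -/
  hFactor : ℝ
  one_lt_hFactor : 1 < hFactor
  /-- open or closed balls, for edges between consecutive levels -/
  vKind : BallKind
  /-- the multiple of `r n` that is the radius, for edges between consecutive levels -/
  vFactor : ℝ
  one_le_vFactor : 1 ≤ vFactor
  /-- overlap or containment -/
  vRule : VerticalRule
  /-- for the containment rule the balls are large enough: if `z` is within `r n` of the centre of
  a ball of level `n` and within `r (n + 1)` of the centre of a ball of level `n + 1`, then the
  former ball contains the latter; the usual choice is `vFactor = 2` and `ratio ≥ 6` -/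
  vFactor_large : vRule = .containment → 1 + (1 + vFactor) / ratio ≤ vFactor

namespace HyperbolicFilling

variable {Z : Type*} [MetricSpace Z] (X : HyperbolicFilling Z)

/-- The vertex set: the disjoint union of the levels `net n`. -/
@[ext]
structure Vertex where
  /-- the level of the vertex -/
  level : ℕ
  /-- the centre of the associated ball -/
  center : Z
  mem : center ∈ X.net level

/-- The ball of the vertex `v` used for edges within one level. -/
def hBall (v : X.Vertex) : Set Z :=
  X.hKind.ball v.center (X.hFactor * (X.scale / X.ratio ^ v.level))

/-- The ball of the vertex `v` used for edges between consecutive levels. -/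
def vBall (v : X.Vertex) : Set Z :=
  X.vKind.ball v.center (X.vFactor * (X.scale / X.ratio ^ v.level))

/-- The graph on the vertex set. -/
def graph : SimpleGraph X.Vertex where
  Adj v w := v ≠ w ∧
    ((v.level = w.level ∧ (X.hBall v ∩ X.hBall w).Nonempty) ∨
      (w.level = v.level + 1 ∧ X.vRule.holds (X.vBall v) (X.vBall w)) ∨
      (v.level = w.level + 1 ∧ X.vRule.holds (X.vBall w) (X.vBall v)))
  symm := ⟨by
    rintro v w ⟨hne, h⟩
    refine ⟨hne.symm, ?_⟩
    rcases h with ⟨h1, h2⟩ | h | h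
    · exact Or.inl ⟨h1.symm, by rwa [Set.inter_comm]⟩
    · exact Or.inr (Or.inr h)
    · exact Or.inr (Or.inl h)⟩
  loopless := ⟨fun _ h => h.1 rfl⟩

theorem radius_pos (n : ℕ) : 0 < X.scale / X.ratio ^ n :=
  div_pos X.scale_pos (pow_pos (lt_trans one_pos X.one_lt_ratio) n)

/-- Every vertex of positive level has a neighbour in the preceding level. -/
theorem exists_parent (n : ℕ) (w : X.Vertex) (hw : w.level = n + 1) :
    ∃ v : X.Vertex, v.level = n ∧ X.graph.Adj v w := by
  obtain ⟨p, hp, hd⟩ := X.covers n w.center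
  have hr := X.radius_pos n
  have hs : 0 < X.ratio := lt_trans one_pos X.one_lt_ratio
  have hv := X.one_le_vFactor
  refine ⟨⟨n, p, hp⟩, rfl, fun h => ?_, Or.inr (Or.inl ⟨hw, ?_⟩)⟩
  · have h1 := congrArg Vertex.level h
    simp only at h1
    omega
  · have hr1 := X.radius_pos (n + 1)
    have hstep : X.scale / X.ratio ^ (n + 1) = X.scale / X.ratio ^ n / X.ratio := by
      rw [pow_succ, div_div]
    set r := X.scale / X.ratio ^ n
    cases hrule : X.vRule with
    | overlap =>
      refine ⟨w.center, ?_, ?_⟩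
      · cases hk : X.vKind
        · simp only [vBall, hk, BallKind.ball, Metric.mem_ball]
          nlinarith
        · simp only [vBall, hk, BallKind.ball, Metric.mem_closedBall]
          nlinarith
      · cases hk : X.vKind
        · simp only [vBall, hk, BallKind.ball, Metric.mem_ball, dist_self, hw]
          positivity
        · simp only [vBall, hk, BallKind.ball, Metric.mem_closedBall, dist_self, hw]
          positivity
    | containment =>
      have hlarge := X.vFactor_large hrule
      have key : X.vFactor * (r / X.ratio) + dist w.center p ≤ X.vFactor * r := by
        have h2 : X.vFactor * (r / X.ratio) = X.vFactor / X.ratio * r := by ring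
        have h3 : X.vFactor / X.ratio ≤ (1 + X.vFactor) / X.ratio := by gcongr; linarith
        nlinarith
      cases hk : X.vKind
      · simp only [VerticalRule.holds, vBall, hk, BallKind.ball, hw, hstep]
        exact Metric.ball_subset_ball' key
      · simp only [VerticalRule.holds, vBall, hk, BallKind.ball, hw, hstep]
        exact Metric.closedBall_subset_closedBall' key

theorem graph_connected : X.graph.Connected := by
  obtain ⟨p, hp⟩ := X.net_zero
  let o : X.Vertex := ⟨0, p, by rw [hp]; rfl⟩
  have key : ∀ (n : ℕ) (w : X.Vertex), w.level = n → X.graph.Reachable o w := by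
    intro n
    induction n with
    | zero =>
      rintro ⟨l, q, hq⟩ hl
      simp only at hl
      subst hl
      have hqp : q = p := by
        rw [hp] at hq
        exact hq
      subst hqp
      exact SimpleGraph.Reachable.refl _
    | succ n ih =>
      intro w hw
      obtain ⟨v, hvl, hvw⟩ := X.exists_parent n w hw
      exact (ih v hvl).trans hvw.reachable
  exact SimpleGraph.connected_iff_exists_forall_reachable _ |>.2 ⟨o, fun w => key _ w rfl⟩

/-- The vertex set with the graph metric: the distance of two vertices is the least number of
edges of a path that joins them. -/
noncomputable instance : MetricSpace X.Vertex where
  dist v w := (X.graph.dist v w : ℝ)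
  dist_self v := by simp
  dist_comm v w := by rw [SimpleGraph.dist_comm]
  dist_triangle u v w := by exact_mod_cast X.graph_connected.dist_triangle
  eq_of_dist_eq_zero h := X.graph_connected.dist_eq_zero_iff.1 (by exact_mod_cast h)

end HyperbolicFilling

/-! A vertex records a location and a scale, and so does a pair of distinct points. An Ahlfors
regular space with more than one point is uniformly perfect, so each vertex `v` has a partner point
at distance comparable to its radius (`exists_represents_center`); conversely each pair is
represented by a vertex (`exists_represents`). Vertices at bounded graph distance correspond to
comparable pairs, in both directions (`Represents.exists_pairComparable`,
`Represents.exists_dist_le`). A quasisymmetry and its inverse preserve comparability of pairs, hence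
induce Lipschitz maps `F`, `G` of the vertex sets that are coarsely inverse to each other.

A quasi-isometry need not be close to a bijection; here growth makes it so. Fibres of `F` have
bounded diameter, hence bounded cardinality (`exists_encard_le`), while each target vertex owns a
cluster of as many nearby vertices as desired, disjoint from all other clusters
(`exists_disjoint_clusters`). Spreading fibres over clusters moves `F` a bounded amount to an
injection; the same holds for `G`. A Schroeder–Bernstein argument turns the two injections into a
bijection close to `F`, and this is bilipschitz because distinct vertices are at distance at least
1. Two fillings of one space are compared through the identity map. -/

/-! ### Quasisymmetries and comparable pairs of points -/

theorem strictMono_homeomorph_nnreal (η : ℝ≥0 ≃ₜ ℝ≥0) : StrictMono η := by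
  rcases η.continuous.strictMono_of_inj η.injective with h | h
  · exact h
  -- A decreasing `η` would have its maximum at 0, yet `η 0 + 1` is attained.
  · obtain ⟨x, hx⟩ := η.surjective (η 0 + 1)
    have h1 := h.antitone (zero_le (a := x))
    rw [hx] at h1
    exact absurd h1 (not_le.2 (lt_add_one _))

theorem homeomorph_nnreal_zero (η : ℝ≥0 ≃ₜ ℝ≥0) : η 0 = 0 := by
  obtain ⟨x, hx⟩ := η.surjective 0
  have h := (strictMono_homeomorph_nnreal η).monotone (zero_le (a := x))
  rw [hx] at h
  exact le_antisymm h zero_le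

/-- A map is ratio bounded if bounded ratios of distances from a common
point are sent to bounded ratios. -/
def IsRatioBounded {Z W : Type*} [MetricSpace Z] [MetricSpace W] (f : Z → W) : Prop :=
  ∀ T : ℝ, 0 ≤ T → ∃ T' : ℝ, 0 ≤ T' ∧ ∀ x y z : Z,
    dist x y ≤ T * dist x z → dist (f x) (f y) ≤ T' * dist (f x) (f z)

section

variable {Z W : Type*} [MetricSpace Z] [MetricSpace W]

theorem IsQuasisymmetry.dist_le {f : Z ≃ₜ W} {η : ℝ≥0 ≃ₜ ℝ≥0}
    (hη : ∀ x y z : Z, x ≠ z →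
      nndist (f x) (f y) / nndist (f x) (f z) ≤ η (nndist x y / nndist x z))
    {T : ℝ≥0} {x y z : Z} (h : dist x y ≤ T * dist x z) :
    dist (f x) (f y) ≤ η T * dist (f x) (f z) := by
  rcases eq_or_ne x z with rfl | hxz
  · have : x = y := by simpa using h
    simp [this]
  have h1 : nndist x y ≤ T * nndist x z := by exact_mod_cast h
  have hpos : 0 < nndist x z := by
    rw [pos_iff_ne_zero]
    simpa using hxz
  have hpos' : 0 < nndist (f x) (f z) := by
    rw [pos_iff_ne_zero]
    simpa using hxz
  have h2 : nndist x y / nndist x z ≤ T := by rwa [div_le_iff₀ hpos]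
  have h3 := (hη x y z hxz).trans ((strictMono_homeomorph_nnreal η).monotone h2)
  rw [div_le_iff₀ hpos'] at h3
  exact_mod_cast h3

theorem IsQuasisymmetry.isRatioBounded {f : Z ≃ₜ W} (hf : IsQuasisymmetry f) :
    IsRatioBounded f := by
  obtain ⟨η, hη⟩ := hf
  intro T hT
  lift T to ℝ≥0 using hT
  exact ⟨η T, (η T).2, fun x y z => IsQuasisymmetry.dist_le hη⟩

/-- Since `η` tends to 0 at 0, some `t > 0` has `η t = 1 / (T + 1)`. If the ratio of the preimages
exceeded `1 / t`, applying `f` to the reversed ratio would give `(T + 1) * dist x z ≤ dist x y ≤ T *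
dist x z`, so all three points would coincide. -/
theorem IsQuasisymmetry.isRatioBounded_symm {f : Z ≃ₜ W} (hf : IsQuasisymmetry f) :
    IsRatioBounded f.symm := by
  obtain ⟨η, hη⟩ := hf
  intro T hT
  lift T to ℝ≥0 using hT
  have hpos : 0 < η.symm (T + 1)⁻¹ := by
    rw [pos_iff_ne_zero]
    intro h
    have h1 := congrArg η h
    rw [η.apply_symm_apply, homeomorph_nnreal_zero] at h1
    exact (inv_ne_zero (by positivity)) h1
  set t : ℝ≥0 := η.symm (T + 1)⁻¹ with ht
  have hηt : ((η t : ℝ≥0) : ℝ) = ((T : ℝ) + 1)⁻¹ := by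
    rw [ht, η.apply_symm_apply, NNReal.coe_inv, NNReal.coe_add, NNReal.coe_one]
  have ht0 : (0 : ℝ) < t := hpos
  refine ⟨(t : ℝ)⁻¹, by positivity, fun x y z h => ?_⟩
  by_contra! hlt
  have h1 : dist (f.symm x) (f.symm z) ≤ t * dist (f.symm x) (f.symm y) := by
    rw [inv_mul_eq_div, div_lt_iff₀ ht0] at hlt
    linarith
  have h2 := IsQuasisymmetry.dist_le hη h1
  simp only [f.apply_symm_apply, hηt] at h2
  rw [inv_mul_eq_div, le_div_iff₀ (by positivity)] at h2
  have hxz : dist x z = 0 := by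
    have := dist_nonneg (x := x) (y := z)
    nlinarith
  rw [hxz, mul_zero] at h
  have hxy : x = y := dist_le_zero.1 h
  subst hxy
  rw [dist_self] at hlt
  exact absurd hlt (not_lt.2 (by positivity))

theorem isRatioBounded_id : IsRatioBounded (id : Z → Z) :=
  fun T hT => ⟨T, hT, fun _ _ _ h => h⟩

/-- Two pairs of points have comparable diameters and lie at distance at most comparable to
their diameters. -/
structure PairComparable (T : ℝ) (a b c d : Z) : Prop where
  le_left : dist a c ≤ T * dist a b
  le_right : dist a c ≤ T * dist c d
  left_le : dist a b ≤ T * dist c d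
  right_le : dist c d ≤ T * dist a b

namespace PairComparable

theorem symm {T : ℝ} {a b c d : Z} (h : PairComparable T a b c d) : PairComparable T c d a b :=
  ⟨dist_comm a c ▸ h.le_right, dist_comm a c ▸ h.le_left, h.right_le, h.left_le⟩

theorem trans {T S : ℝ} (hT : 0 ≤ T) (hS : 0 ≤ S) {a b c d e g : Z}
    (h : PairComparable T a b c d) (h' : PairComparable S c d e g) :
    PairComparable (T * S + T + S) a b e g := by
  have h1 := mul_le_mul_of_nonneg_left h'.left_le hT
  have h2 := mul_le_mul_of_nonneg_left h.right_le hS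
  have hab := dist_nonneg (x := a) (y := b)
  have heg := dist_nonneg (x := e) (y := g)
  have tri := dist_triangle a c e
  have p1 := mul_nonneg hT hab
  have p2 := mul_nonneg hS hab
  have p3 := mul_nonneg hT heg
  have p4 := mul_nonneg hS heg
  constructor
  · linarith [h.le_left, h'.le_left]
  · linarith [h.le_right, h'.le_right]
  · linarith [h.left_le]
  · linarith [h'.right_le]

end PairComparable

/-- Ratio bounds only compare distances from a common point, here `c`: both `a` and `b` lie within
`2 * T * dist c d` of it, so the images of `a` and `b` are controlled by that of `(c, d)`. The other
inequalities follow by exchanging the pairs. -/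
theorem IsRatioBounded.exists_pairComparable {f : Z → W} (hf : IsRatioBounded f) {T : ℝ}
    (hT : 0 ≤ T) : ∃ T' : ℝ, 0 ≤ T' ∧ ∀ a b c d : Z, PairComparable T a b c d →
      PairComparable T' (f a) (f b) (f c) (f d) := by
  obtain ⟨T₁, hT₁, h₁⟩ := hf T hT
  obtain ⟨T₂, hT₂, h₂⟩ := hf (2 * T) (by positivity)
  have half : ∀ a b c d : Z, PairComparable T a b c d →
      dist (f a) (f c) ≤ T₁ * dist (f c) (f d) ∧
      dist (f a) (f b) ≤ (T₁ + T₂) * dist (f c) (f d) := by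
    intro a b c d h
    have h3 := h₁ c a d (dist_comm a c ▸ h.le_right)
    have h4 := h₂ c b d (by linarith [dist_triangle c a b, dist_comm a c, h.le_right, h.left_le])
    refine ⟨dist_comm (f c) (f a) ▸ h3, ?_⟩
    linarith [dist_triangle (f a) (f c) (f b), dist_comm (f c) (f a)]
  refine ⟨T₁ + T₂, by positivity, fun a b c d h => ?_⟩
  obtain ⟨h3, h4⟩ := half a b c d h
  obtain ⟨h5, h6⟩ := half c d a b h.symm
  have p1 := mul_nonneg hT₂ (dist_nonneg (x := f a) (y := f b))
  have p2 := mul_nonneg hT₂ (dist_nonneg (x := f c) (y := f d))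
  exact ⟨by linarith [dist_comm (f a) (f c)], by linarith, h4, h6⟩

end

/-! ### Packing and covering in Ahlfors regular spaces -/

section

variable {Z : Type*} [MetricSpace Z]

/-- Two-sided polynomial bounds for the measures of balls, the lower one at bounded scales. -/
theorem IsAhlforsRegular.exists_measure_bounds [CompactSpace Z] [Nontrivial Z]
    [MeasurableSpace Z] [BorelSpace Z] (hZ : IsAhlforsRegular Z) {R : ℝ} (hR : 0 < R) :
    ∃ (μ : Measure Z) (Q c C : ℝ), 0 < Q ∧ 0 < c ∧ 0 < C ∧
      (∀ x r, 0 < r → r ≤ R → ENNReal.ofReal (c * r ^ Q) ≤ μ (Metric.ball x r)) ∧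
      (∀ x r, 0 < r → μ (Metric.ball x r) ≤ ENNReal.ofReal (C * r ^ Q)) := by
  obtain ⟨Q, hQ, c, C, hc, hC, h⟩ := hZ
  set Δ := Metric.diam (Set.univ : Set Z) with hΔ
  have hΔ0 : 0 < Δ := by
    obtain ⟨a, b, hab⟩ := exists_pair_ne Z
    exact (dist_pos.2 hab).trans_le
      (Metric.dist_le_diam_of_mem isCompact_univ.isBounded (Set.mem_univ a) (Set.mem_univ b))
  set μ : Measure Z := Measure.hausdorffMeasure Q
  have hfin : μ Set.univ < ∞ := by
    obtain ⟨t, -, htf, ht⟩ := Metric.totallyBounded_iff.1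
      (isCompact_univ (X := Z)).totallyBounded Δ hΔ0 |> fun ⟨t, h1, h2⟩ =>
        (⟨t, trivial, h1, h2⟩ : ∃ t : Set Z, True ∧ t.Finite ∧ Set.univ ⊆ ⋃ y ∈ t, Metric.ball y Δ)
    refine (measure_mono ht).trans_lt ((measure_biUnion_lt_top htf) fun y _ => ?_)
    exact (h y Δ hΔ0 le_rfl).2.trans_lt ENNReal.ofReal_lt_top
  set M := (μ Set.univ).toReal
  -- Regularity is only given up to radius `Δ`. For the lower bound, radii up to `R` are shrunk
  -- below `Δ` by the factor `min 1 (Δ / R)`; for the upper bound beyond `Δ`, the total mass `M` is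
  -- at most `M / Δ ^ Q * r ^ Q`.
  refine ⟨μ, Q, c * (min 1 (Δ / R)) ^ Q, C + M / Δ ^ Q, hQ, by positivity, by positivity,
    fun x r hr hrR => ?_, fun x r hr => ?_⟩
  · have hm : 0 < min 1 (Δ / R) := by positivity
    have h1 : min 1 (Δ / R) * r ≤ Δ := by
      calc min 1 (Δ / R) * r ≤ (Δ / R) * R := by gcongr; exact min_le_right _ _
        _ = Δ := by field_simp
    have h2 := (h x (min 1 (Δ / R) * r) (by positivity) h1).1
    rw [Real.mul_rpow hm.le hr.le, ← mul_assoc] at h2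
    refine h2.trans (measure_mono (Metric.ball_subset_ball ?_))
    exact mul_le_of_le_one_left hr.le (min_le_left _ _)
  · rcases le_total r Δ with hrΔ | hrΔ
    · refine (h x r hr hrΔ).2.trans (ENNReal.ofReal_le_ofReal ?_)
      gcongr
      have : 0 ≤ M / Δ ^ Q := by positivity
      linarith
    · calc μ (Metric.ball x r) ≤ μ Set.univ := measure_mono (Set.subset_univ _)
        _ = ENNReal.ofReal M := (ENNReal.ofReal_toReal hfin.ne).symm
        _ ≤ _ := ENNReal.ofReal_le_ofReal ?_
      have h3 : Δ ^ Q ≤ r ^ Q := by gcongr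
      have h4 : 0 < Δ ^ Q := by positivity
      calc M = M / Δ ^ Q * Δ ^ Q := by field_simp
        _ ≤ M / Δ ^ Q * r ^ Q := by gcongr
        _ ≤ _ := by
          have : 0 ≤ C * r ^ Q := by positivity
          linarith

/-- Separated subsets of a ball have bounded cardinality. -/
theorem IsAhlforsRegular.exists_card_separated_le [CompactSpace Z] [Nontrivial Z]
    [MeasurableSpace Z] [BorelSpace Z] (hZ : IsAhlforsRegular Z) {R : ℝ} (hR : 0 < R) {T : ℝ}
    (hT : 0 ≤ T) :
    ∃ N : ℕ, ∀ (x : Z) (r : ℝ), 0 < r → r ≤ R → ∀ A : Finset Z,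
      (∀ a ∈ A, dist a x ≤ T * r) → (A : Set Z).Pairwise (fun a b => r ≤ dist a b) →
      A.card ≤ N := by
  obtain ⟨μ, Q, c, C, hQ, hc, hC, hlow, hup⟩ := hZ.exists_measure_bounds hR
  -- The disjoint balls of radius `r / 2` about the points of `A` all lie in the ball of radius `(T
  -- + 1) * r` about `x`; this is the quotient of the measure bounds.
  obtain ⟨N, hN⟩ := exists_nat_ge (C * (T + 1) ^ Q / (c * (1 / 2) ^ Q))
  refine ⟨N, fun x r hr hrR A hA hsep => ?_⟩
  have hdisj : (A : Set Z).PairwiseDisjoint fun a => Metric.ball a (r / 2) := by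
    intro a ha b hb hab
    exact Metric.ball_disjoint_ball (by linarith [hsep ha hb hab])
  have h1 : (A.card : ℝ≥0∞) * ENNReal.ofReal (c * (r / 2) ^ Q) ≤
      ENNReal.ofReal (C * ((T + 1) * r) ^ Q) := by
    calc (A.card : ℝ≥0∞) * ENNReal.ofReal (c * (r / 2) ^ Q)
        = ∑ a ∈ A, ENNReal.ofReal (c * (r / 2) ^ Q) := by simp
      _ ≤ ∑ a ∈ A, μ (Metric.ball a (r / 2)) :=
        Finset.sum_le_sum fun a _ => hlow a _ (by positivity) (by linarith)
      _ = μ (⋃ a ∈ A, Metric.ball a (r / 2)) :=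
        (measure_biUnion_finset hdisj fun a _ => Metric.isOpen_ball.measurableSet).symm
      _ ≤ μ (Metric.ball x ((T + 1) * r)) := measure_mono <| Set.iUnion₂_subset fun a ha =>
        Metric.ball_subset_ball' (by linarith [hA a ha])
      _ ≤ _ := hup x _ (by positivity)
  rw [← ENNReal.ofReal_natCast, ← ENNReal.ofReal_mul (by positivity),
    ENNReal.ofReal_le_ofReal_iff (by positivity), Real.mul_rpow (by positivity) hr.le,
    div_eq_mul_one_div, Real.mul_rpow hr.le (by norm_num)] at h1
  have hrQ : 0 < r ^ Q := by positivity
  have h2 : (A.card : ℝ) * (c * (1 / 2) ^ Q) ≤ C * (T + 1) ^ Q := by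
    refine le_of_mul_le_mul_right ?_ hrQ
    linarith
  rw [← le_div_iff₀ (by positivity)] at h2
  exact_mod_cast h2.trans hN

/-- Covering a ball by balls of much smaller radius takes many of them. -/
theorem IsAhlforsRegular.exists_le_card_cover [CompactSpace Z] [Nontrivial Z]
    [MeasurableSpace Z] [BorelSpace Z] (hZ : IsAhlforsRegular Z) {R : ℝ} (hR : 0 < R) (N : ℕ) :
    ∃ ε : ℝ, 0 < ε ∧ ∀ (x : Z) (r : ℝ), 0 < r → r ≤ R → ∀ A : Finset Z,
      Metric.ball x r ⊆ ⋃ a ∈ A, Metric.ball a (ε * r) → N ≤ A.card := by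
  obtain ⟨μ, Q, c, C, hQ, hc, hC, hlow, hup⟩ := hZ.exists_measure_bounds hR
  -- Chosen so that a ball of radius `ε * r` has at most the fraction `1 / (N + 1)` of the lower
  -- bound for a ball of radius `r`.
  set ε : ℝ := (c / (C * (N + 1))) ^ (1 / Q) with hε
  have hε0 : 0 < ε := by positivity
  have hεQ : ε ^ Q = c / (C * (N + 1)) := by
    rw [hε, ← Real.rpow_mul (by positivity), one_div_mul_cancel hQ.ne', Real.rpow_one]
  refine ⟨ε, hε0, fun x r hr hrR A hA => ?_⟩
  have h1 : ENNReal.ofReal (c * r ^ Q) ≤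
      (A.card : ℝ≥0∞) * ENNReal.ofReal (C * (ε * r) ^ Q) := by
    calc ENNReal.ofReal (c * r ^ Q) ≤ μ (Metric.ball x r) := hlow x r hr hrR
      _ ≤ μ (⋃ a ∈ A, Metric.ball a (ε * r)) := measure_mono hA
      _ ≤ ∑ a ∈ A, μ (Metric.ball a (ε * r)) := measure_biUnion_finset_le _ _
      _ ≤ ∑ a ∈ A, ENNReal.ofReal (C * (ε * r) ^ Q) :=
        Finset.sum_le_sum fun a _ => hup a _ (by positivity)
      _ = _ := by simp
  rw [← ENNReal.ofReal_natCast, ← ENNReal.ofReal_mul (by positivity),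
    ENNReal.ofReal_le_ofReal_iff (by positivity), Real.mul_rpow hε0.le hr.le, hεQ] at h1
  have hrQ : 0 < r ^ Q := by positivity
  have h2 : c ≤ A.card * (C * (c / (C * (N + 1)))) := by
    refine le_of_mul_le_mul_right ?_ hrQ
    linarith
  have h3 : (A.card : ℝ) * (C * (c / (C * (N + 1)))) = A.card * c / (N + 1) := by
    field_simp
  rw [h3, le_div_iff₀ (by positivity), mul_comm] at h2
  have h4 : ((N : ℝ) + 1) ≤ A.card := le_of_mul_le_mul_right h2 hc
  have : N + 1 ≤ A.card := by exact_mod_cast h4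
  omega

/-- An Ahlfors regular space is uniformly perfect. -/
theorem IsAhlforsRegular.exists_uniformlyPerfect [CompactSpace Z] [Nontrivial Z]
    [MeasurableSpace Z] [BorelSpace Z] (hZ : IsAhlforsRegular Z) {R : ℝ} (hR : 0 < R) :
    ∃ K : ℝ, 0 < K ∧ ∀ (x : Z) (r : ℝ), 0 < r → r ≤ R →
      ∃ y, dist x y ≤ r ∧ r ≤ K * dist x y := by
  -- If no point lay at distance between `ε * r` and `r` from `x`, the single ball of radius `ε * r`
  -- about `x` would cover the ball of radius `r`.
  obtain ⟨ε, hε, h⟩ := hZ.exists_le_card_cover hR 2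
  refine ⟨ε⁻¹, by positivity, fun x r hr hrR => ?_⟩
  by_contra! hcon
  have := h x r hr hrR {x} (by
    intro y hy
    simp only [Finset.mem_singleton, Set.iUnion_iUnion_eq_left, Metric.mem_ball] at hy ⊢
    have h1 := hcon y (by rw [dist_comm]; exact hy.le)
    rw [inv_mul_eq_div, div_lt_iff₀ hε, dist_comm] at h1
    linarith)
  simp at this

end

/-! ### Graph distance versus radii and centres -/

namespace HyperbolicFilling

variable {Z : Type*} [MetricSpace Z] (X : HyperbolicFilling Z)

/-- The radius of the covering balls of level `n`. -/
noncomputable def rad (n : ℕ) : ℝ := X.scale / X.ratio ^ n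

variable {X}

theorem ratio_pos : 0 < X.ratio := one_pos.trans X.one_lt_ratio

theorem rad_pos (n : ℕ) : 0 < X.rad n := X.radius_pos n

theorem rad_zero : X.rad 0 = X.scale := by simp [rad]

theorem ratio_mul_rad_succ (n : ℕ) : X.ratio * X.rad (n + 1) = X.rad n := by
  have := ratio_pos (X := X)
  rw [rad, rad, pow_succ]
  field_simp

theorem ratio_pow_mul_rad_add (n k : ℕ) : X.ratio ^ k * X.rad (n + k) = X.rad n := by
  have := ratio_pos (X := X)
  rw [rad, rad, pow_add]
  field_simp

theorem rad_strictAnti : StrictAnti X.rad := by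
  refine strictAnti_nat_of_succ_lt fun n => ?_
  rw [← ratio_mul_rad_succ n]
  exact lt_mul_of_one_lt_left (rad_pos _) X.one_lt_ratio

theorem rad_le_scale (n : ℕ) : X.rad n ≤ X.scale :=
  rad_zero (X := X) ▸ rad_strictAnti.antitone (Nat.zero_le n)

theorem exists_rad_le {t : ℝ} (ht : 0 < t) : ∃ n, X.rad n ≤ t := by
  obtain ⟨n, hn⟩ := pow_unbounded_of_one_lt (X.scale / t) X.one_lt_ratio
  refine ⟨n, ?_⟩
  rw [div_lt_iff₀ ht] at hn
  rw [rad, div_le_iff₀ (pow_pos ratio_pos n)]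
  linarith

/-- If the radii of two levels are comparable then so are the levels. -/
theorem level_le_of_rad_le {T : ℝ} {k m n : ℕ} (hk : T < X.ratio ^ k)
    (h : X.rad m ≤ T * X.rad n) : n ≤ m + k := by
  by_contra! hlt
  have h1 := ratio_pow_mul_rad_add (X := X) m k
  have h2 := rad_strictAnti (X := X) hlt
  have h3 := rad_pos (X := X) n
  have h4 : 0 < X.ratio ^ k := pow_pos ratio_pos k
  nlinarith

theorem _root_.BallKind.mem_ball_of_dist_lt {k : BallKind} {x z : Z} {r : ℝ} (h : dist z x < r) :
    z ∈ k.ball x r := by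
  cases k
  · exact h
  · exact h.le

theorem _root_.BallKind.dist_le_of_mem_ball {k : BallKind} {x z : Z} {r : ℝ} (h : z ∈ k.ball x r) :
    dist z x ≤ r := by
  cases k
  · exact le_of_lt h
  · exact h

theorem _root_.BallKind.ball_subset_ball {k : BallKind} {x y : Z} {r s : ℝ} (h : s + dist y x ≤ r) :
    k.ball y s ⊆ k.ball x r := by
  cases k
  · exact Metric.ball_subset_ball' h
  · exact Metric.closedBall_subset_closedBall' h

theorem dist_eq (v w : X.Vertex) : dist v w = X.graph.dist v w := rfl

theorem dist_le_one_of_adj {v w : X.Vertex} (h : X.graph.Adj v w) : dist v w ≤ 1 := by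
  rw [dist_eq, SimpleGraph.dist_eq_one_iff_adj.2 h, Nat.cast_one]

theorem one_le_dist {v w : X.Vertex} (h : v ≠ w) : 1 ≤ dist v w := by
  rw [dist_eq]
  exact_mod_cast X.graph_connected.pos_dist_of_ne h

/-- The covering ball of the vertex `v` contains `z`. -/
def Near (v : X.Vertex) (z : Z) : Prop := dist z v.center < X.rad v.level

theorem near_center (v : X.Vertex) : Near v v.center := by
  rw [Near, dist_self]
  exact rad_pos _

theorem exists_near (n : ℕ) (z : Z) : ∃ v : X.Vertex, v.level = n ∧ Near v z := by
  obtain ⟨p, hp, h⟩ := X.covers n z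
  exact ⟨⟨n, p, hp⟩, rfl, h⟩

/-- As `hFactor > 1`, the enlarged balls exceed the covering balls by `(hFactor - 1)` radii, enough
for `z'` to lie in both. -/
theorem dist_le_one_of_level_eq {v w : X.Vertex} {z z' : Z} (hv : Near v z) (hw : Near w z')
    (hl : v.level = w.level) (h : dist z z' ≤ (X.hFactor - 1) * X.rad w.level) :
    dist v w ≤ 1 := by
  rcases eq_or_ne v w with rfl | hne
  · simp
  refine dist_le_one_of_adj ⟨hne, Or.inl ⟨hl, z', ?_, ?_⟩⟩
  · refine BallKind.mem_ball_of_dist_lt ?_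
    change _ < X.hFactor * X.rad v.level
    rw [Near] at hv
    rw [hl] at hv ⊢
    linarith [dist_triangle z' z v.center, dist_comm z z']
  · refine BallKind.mem_ball_of_dist_lt ?_
    change _ < X.hFactor * X.rad w.level
    rw [Near] at hw
    nlinarith [X.one_lt_hFactor, rad_pos (X := X) w.level]

/-- Under the overlap rule `z` is a common point. Under the containment rule the centres are less
than the sum of the two radii apart, which is what `vFactor_large` is made for. -/
theorem dist_le_one_of_level_succ {v w : X.Vertex} {z : Z} (hv : Near v z) (hw : Near w z)
    (hl : w.level = v.level + 1) : dist v w ≤ 1 := by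
  refine dist_le_one_of_adj ⟨fun h => by simp [h] at hl, Or.inr (Or.inl ⟨hl, ?_⟩)⟩
  have hvF := X.one_le_vFactor
  have hr := rad_pos (X := X) v.level
  have hr' := rad_pos (X := X) w.level
  rw [Near] at hv hw
  cases hrule : X.vRule with
  | overlap =>
    refine ⟨z, BallKind.mem_ball_of_dist_lt ?_, BallKind.mem_ball_of_dist_lt ?_⟩
    · change _ < X.vFactor * X.rad v.level
      nlinarith
    · change _ < X.vFactor * X.rad w.level
      nlinarith
  | containment =>
    refine BallKind.ball_subset_ball ?_
    change X.vFactor * X.rad w.level + _ ≤ X.vFactor * X.rad v.level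
    have hlarge := X.vFactor_large hrule
    have h1 := ratio_mul_rad_succ (X := X) v.level
    rw [← hl] at h1
    have h2 : (1 + X.vFactor) / X.ratio * X.rad v.level = (1 + X.vFactor) * X.rad w.level := by
      have := ratio_pos (X := X)
      rw [← h1]
      field_simp
    nlinarith [dist_triangle w.center z v.center, dist_comm w.center z]

/-- Vertices near `z` on successive levels form a path. The extra 1 is for two different vertices of
one level near `z`. -/
theorem dist_le_of_near {z : Z} (k : ℕ) {v w : X.Vertex} (hv : Near v z) (hw : Near w z)
    (hl : w.level = v.level + k) : dist v w ≤ k + 1 := by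
  induction k generalizing w with
  | zero =>
    have := dist_le_one_of_level_eq hv hw hl.symm (by
      rw [dist_self]
      exact mul_nonneg (by linarith [X.one_lt_hFactor]) (rad_pos _).le)
    simpa using this
  | succ k ih =>
    obtain ⟨u, hu, huz⟩ := X.exists_near (v.level + k) z
    have h1 := ih huz hu
    have h2 := dist_le_one_of_level_succ huz hw (by omega)
    push_cast
    linarith [dist_triangle v u w]

/-- The path climbs over `z` to level `j`, crosses by at most one edge and descends over `z'`. At
level 0 the root is the only vertex, so crossing needs no hypothesis. -/
theorem dist_le_of_common_level {z z' : Z} {v w : X.Vertex} (hv : Near v z) (hw : Near w z')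
    {j k l : ℕ} (hk : v.level = j + k) (hl : w.level = j + l)
    (h : j = 0 ∨ dist z z' ≤ (X.hFactor - 1) * X.rad j) : dist v w ≤ k + l + 3 := by
  obtain ⟨u, hu, huz⟩ := X.exists_near j z
  obtain ⟨u', hu', huz'⟩ := X.exists_near j z'
  have h1 := dist_le_of_near k huz hv (by omega)
  have h2 := dist_le_of_near l huz' hw (by omega)
  have h3 : dist u u' ≤ 1 := by
    rcases h with rfl | h
    · obtain ⟨p, hp⟩ := X.net_zero
      have e1 := u.mem
      have e2 := u'.mem
      rw [hu, hp] at e1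
      rw [hu', hp] at e2
      have : u = u' := Vertex.ext (hu.trans hu'.symm) (e1.trans e2.symm)
      simp [this]
    · exact dist_le_one_of_level_eq huz huz' (hu.trans hu'.symm) (hu' ▸ h)
  linarith [dist_triangle v u w, dist_triangle u u' w, dist_comm v u]

/-- Vertices of comparable radii and comparably close centres are at bounded distance. -/
theorem exists_dist_le (X : HyperbolicFilling Z) (T : ℝ) :
    ∃ D : ℝ, ∀ (v w : X.Vertex) (z z' : Z), Near v z → Near w z' →
      dist z z' ≤ T * X.rad v.level → X.rad v.level ≤ T * X.rad w.level →
      X.rad w.level ≤ T * X.rad v.level → dist v w ≤ D := by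
  have hF : 0 < X.hFactor - 1 := by linarith [X.one_lt_hFactor]
  -- One `k` serves twice: the two levels differ by at most `k`, and `k` levels above the coarser
  -- one the slack in the horizontal balls exceeds `dist z z'`.
  obtain ⟨k, hk⟩ := pow_unbounded_of_one_lt (max T (T / (X.hFactor - 1))) X.one_lt_ratio
  have hk1 := (le_max_left _ _).trans_lt hk
  have hk2 := (le_max_right _ _).trans_lt hk
  refine ⟨4 * k + 3, fun v w z z' hv hw h h1 h2 => ?_⟩
  have l1 := level_le_of_rad_le hk1 h1
  have l2 := level_le_of_rad_le hk1 h2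
  set m := min v.level w.level with hm
  -- The subtraction is truncated: when fewer than `k` levels are available the climb ends at the
  -- root.
  obtain ⟨a, ha⟩ := Nat.exists_eq_add_of_le (show m - k ≤ v.level by omega)
  obtain ⟨b, hb⟩ := Nat.exists_eq_add_of_le (show m - k ≤ w.level by omega)
  have ha' : a ≤ 2 * k := by omega
  have hb' : b ≤ 2 * k := by omega
  have key := dist_le_of_common_level hv hw ha hb (by
    rcases Nat.eq_zero_or_pos (m - k) with h0 | h0
    · exact Or.inl h0
    right
    have e : m - k + k = m := by omega
    have h3 := ratio_pow_mul_rad_add (X := X) (m - k) k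
    rw [e] at h3
    have h4 : X.rad v.level ≤ X.rad m := rad_strictAnti.antitone (min_le_left _ _)
    rw [div_lt_iff₀ hF] at hk2
    rw [← h3]
    have h5 := rad_pos (X := X) v.level
    have h6 : 0 < X.ratio ^ k := pow_pos ratio_pos k
    calc dist z z' ≤ T * X.rad v.level := h
      _ ≤ X.ratio ^ k * (X.hFactor - 1) * X.rad v.level := by gcongr
      _ ≤ X.ratio ^ k * (X.hFactor - 1) * X.rad m := by gcongr
      _ = _ := by ring)
  have ha2 : (a : ℝ) ≤ 2 * k := by exact_mod_cast ha'
  have hb2 : (b : ℝ) ≤ 2 * k := by exact_mod_cast hb'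
  linarith

theorem level_le_succ_of_adj {v w : X.Vertex} (h : X.graph.Adj v w) :
    w.level ≤ v.level + 1 := by
  rcases h.2 with h | h | h <;> omega

theorem exists_dist_center_le_of_adj (X : HyperbolicFilling Z) :
    ∃ C : ℝ, 0 ≤ C ∧ ∀ v w : X.Vertex, X.graph.Adj v w →
      dist v.center w.center ≤ C * X.rad v.level := by
  have hF := X.one_lt_hFactor
  have hvF := X.one_le_vFactor
  have hs := X.one_lt_ratio
  have vert : ∀ v w : X.Vertex, w.level = v.level + 1 → X.vRule.holds (X.vBall v) (X.vBall w) →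
      dist v.center w.center ≤ 2 * X.vFactor * X.rad v.level := by
    intro v w hl h
    have hne : (X.vBall v ∩ X.vBall w).Nonempty := by
      cases hrule : X.vRule with
      | overlap => rwa [hrule] at h
      | containment =>
        rw [hrule] at h
        have hw : w.center ∈ X.vBall w := BallKind.mem_ball_of_dist_lt (by
          rw [dist_self]
          exact mul_pos (by linarith) (rad_pos w.level))
        exact ⟨w.center, h hw, hw⟩
    obtain ⟨z, hz, hz'⟩ := hne
    have h1 : _ ≤ X.vFactor * X.rad v.level := BallKind.dist_le_of_mem_ball hz
    have h2 : _ ≤ X.vFactor * X.rad w.level := BallKind.dist_le_of_mem_ball hz'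
    have h3 : X.rad w.level ≤ X.rad v.level := rad_strictAnti.antitone (by omega)
    nlinarith [dist_triangle_left v.center w.center z]
  -- The factor `X.ratio` is needed when `w` is on the coarser level, whose radius is `X.ratio`
  -- times that of `v`.
  refine ⟨2 * X.hFactor + 2 * X.vFactor * X.ratio, by positivity, fun v w h => ?_⟩
  have hr := rad_pos (X := X) v.level
  have p1 : 0 ≤ X.hFactor * X.rad v.level := by positivity
  have p2 : 0 ≤ X.vFactor * X.rad v.level := by positivity
  rcases h.2 with ⟨hl, z, hz, hz'⟩ | ⟨hl, h⟩ | ⟨hl, h⟩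
  · have h1 : _ ≤ X.hFactor * X.rad v.level := BallKind.dist_le_of_mem_ball hz
    have h2 : _ ≤ X.hFactor * X.rad w.level := BallKind.dist_le_of_mem_ball hz'
    rw [← hl] at h2
    nlinarith [dist_triangle_left v.center w.center z]
  · nlinarith [vert v w hl h]
  · have h1 := vert w v hl h
    have h2 := ratio_mul_rad_succ (X := X) w.level
    rw [← hl] at h2
    rw [← h2, dist_comm] at h1
    nlinarith

/-- Vertices at bounded distance have comparable radii and comparably close centres. -/
theorem exists_of_dist_le (X : HyperbolicFilling Z) (k : ℕ) :
    ∃ C : ℝ, 0 ≤ C ∧ ∀ v w : X.Vertex, dist v w ≤ k →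
      dist v.center w.center ≤ C * X.rad v.level ∧ X.rad v.level ≤ C * X.rad w.level ∧
        X.rad w.level ≤ C * X.rad v.level := by
  obtain ⟨C₁, hC₁, h₁⟩ := X.exists_dist_center_le_of_adj
  have hs := X.one_lt_ratio
  have adj_rad : ∀ v w : X.Vertex, X.graph.Adj v w → X.rad v.level ≤ X.ratio * X.rad w.level := by
    intro v w h
    have hl := level_le_succ_of_adj h
    rw [← ratio_mul_rad_succ v.level]
    exact mul_le_mul_of_nonneg_left (rad_strictAnti.antitone hl) (by linarith)
  have walk : ∀ k : ℕ, ∃ C : ℝ, 0 ≤ C ∧ ∀ (v w : X.Vertex) (p : X.graph.Walk v w),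
      p.length ≤ k → dist v.center w.center ≤ C * X.rad v.level ∧
        X.rad v.level ≤ C * X.rad w.level ∧ X.rad w.level ≤ C * X.rad v.level := by
    intro k
    induction k with
    | zero =>
      refine ⟨1, zero_le_one, fun v w p hp => ?_⟩
      have := p.eq_of_length_eq_zero (by omega)
      subst this
      have := rad_pos (X := X) v.level
      simp [this.le]
    | succ k ih =>
      obtain ⟨C, hC, h⟩ := ih
      refine ⟨1 + C₁ + X.ratio * C, by positivity, fun v w p hp => ?_⟩
      have hrv := rad_pos (X := X) v.level
      have hrw := rad_pos (X := X) w.level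
      have p1 : 0 ≤ X.ratio * C * X.rad v.level := by positivity
      have p2 : 0 ≤ X.ratio * C * X.rad w.level := by positivity
      have p3 : 0 ≤ C₁ * X.rad v.level := by positivity
      have p4 : 0 ≤ C₁ * X.rad w.level := by positivity
      cases p with
      | nil =>
        rw [dist_self]
        refine ⟨?_, ?_, ?_⟩ <;> nlinarith
      | @cons _ u _ huv p =>
        rw [SimpleGraph.Walk.length_cons] at hp
        obtain ⟨e1, e2, e3⟩ := h u w p (by omega)
        have e4 := h₁ v u huv
        have e5 := adj_rad v u huv
        have e6 := adj_rad u v huv.symm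
        have q1 : X.ratio * X.rad u.level ≤ X.ratio * (C * X.rad w.level) := by gcongr
        have q2 : C * X.rad u.level ≤ C * (X.ratio * X.rad v.level) := by gcongr
        refine ⟨?_, ?_, ?_⟩
        · linarith [dist_triangle v.center u.center w.center]
        · linarith
        · linarith
  obtain ⟨C, hC, h⟩ := walk k
  refine ⟨C, hC, fun v w hvw => ?_⟩
  obtain ⟨p, hp⟩ := X.graph_connected.exists_walk_length_eq_dist v w
  rw [dist_eq] at hvw
  exact h v w p (by rw [hp]; exact_mod_cast hvw)

/-- A map that moves adjacent vertices to bounded distance is Lipschitz. -/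
theorem dist_map_le {Y : Type*} [PseudoMetricSpace Y] {F : X.Vertex → Y} {L : ℝ}
    (h : ∀ v w : X.Vertex, dist v w ≤ 1 → dist (F v) (F w) ≤ L) (v w : X.Vertex) :
    dist (F v) (F w) ≤ L * dist v w := by
  have walk : ∀ (v w : X.Vertex) (p : X.graph.Walk v w),
      dist (F v) (F w) ≤ L * p.length := by
    intro v w p
    induction p with
    | nil => simp
    | @cons v u w huv p ih =>
      rw [SimpleGraph.Walk.length_cons]
      push_cast
      linarith [h v u (dist_le_one_of_adj huv), dist_triangle (F v) (F u) (F w)]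
  obtain ⟨p, hp⟩ := X.graph_connected.exists_walk_length_eq_dist v w
  have := walk v w p
  rwa [hp] at this

theorem abs_level_sub_le_dist (v w : X.Vertex) :
    |(v.level : ℝ) - w.level| ≤ dist v w := by
  have walk : ∀ (v w : X.Vertex) (p : X.graph.Walk v w),
      |(v.level : ℝ) - w.level| ≤ p.length := by
    intro v w p
    induction p with
    | nil => simp
    | @cons v u w huv p ih =>
      have h1 : (u.level : ℝ) ≤ v.level + 1 := by exact_mod_cast level_le_succ_of_adj huv
      have h2 : (v.level : ℝ) ≤ u.level + 1 := by exact_mod_cast level_le_succ_of_adj huv.symm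
      rw [SimpleGraph.Walk.length_cons]
      push_cast
      rw [abs_le] at ih ⊢
      constructor <;> linarith
  obtain ⟨p, hp⟩ := X.graph_connected.exists_walk_length_eq_dist v w
  have := walk v w p
  rwa [hp] at this

end HyperbolicFilling

/-! ### Vertices as pairs of points, and induced maps -/

namespace HyperbolicFilling

variable {Z : Type*} [MetricSpace Z] {X : HyperbolicFilling Z}

/-- The vertex `v` lies near `a`, at the scale of the pair `(a, b)`. -/
structure Represents (K : ℝ) (v : X.Vertex) (a b : Z) : Prop where
  near : Near v a
  rad_le : X.rad v.level ≤ K * dist a b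
  dist_le : dist a b ≤ K * X.rad v.level

theorem Represents.ne {K : ℝ} {v : X.Vertex} {a b : Z} (h : Represents K v a b) : a ≠ b := by
  rintro rfl
  have := h.rad_le
  rw [dist_self, mul_zero] at this
  exact absurd this (not_le.2 (rad_pos _))

theorem Represents.mono {K K' : ℝ} {v : X.Vertex} {a b : Z} (hKK : K ≤ K')
    (h : Represents K v a b) : Represents K' v a b :=
  ⟨h.near, h.rad_le.trans (mul_le_mul_of_nonneg_right hKK dist_nonneg),
    h.dist_le.trans (mul_le_mul_of_nonneg_right hKK (rad_pos _).le)⟩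

/-- Uniform perfectness supplies the partner point. A map of `Z` says nothing about radii, but it
can transport this pair. -/
theorem exists_represents_center (X : HyperbolicFilling Z) [CompactSpace Z] [Nontrivial Z]
    [MeasurableSpace Z] [BorelSpace Z] (hZ : IsAhlforsRegular Z) :
    ∃ (K : ℝ) (e : X.Vertex → Z), 0 ≤ K ∧ ∀ v, Represents K v v.center (e v) := by
  obtain ⟨K, hK, h⟩ := hZ.exists_uniformlyPerfect X.scale_pos
  choose e he he' using fun v : X.Vertex => h v.center _ (rad_pos v.level) (rad_le_scale v.level)
  refine ⟨K + 1, e, by positivity, fun v => ⟨near_center v, ?_, ?_⟩⟩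
  · linarith [he' v, dist_nonneg (x := v.center) (y := e v)]
  · have := rad_pos (X := X) v.level
    nlinarith [he v]

theorem dist_lt_two_mul_scale (X : HyperbolicFilling Z) (a b : Z) : dist a b < 2 * X.scale := by
  obtain ⟨p, hp⟩ := X.net_zero
  have h : ∀ z, dist z p < X.scale := by
    intro z
    obtain ⟨q, hq, hz⟩ := X.covers 0 z
    rw [hp, Set.mem_singleton_iff] at hq
    simpa [hq] using hz
  linarith [dist_triangle_right a b p, h a, h b]

/-- The first level whose radius is at most `dist a b` works: the preceding radius is larger than
`dist a b` and only `ratio` times as big. If that level is 0, `dist a b` is less than twice the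
scale because one ball covers the space. -/
theorem exists_represents (X : HyperbolicFilling Z) :
    ∃ K : ℝ, 0 ≤ K ∧ ∀ a b : Z, a ≠ b → ∃ v : X.Vertex, Represents K v a b := by
  classical
  have hs := X.one_lt_ratio
  refine ⟨2 + X.ratio, by positivity, fun a b hab => ?_⟩
  have hpos := dist_pos.2 hab
  have hex := X.exists_rad_le hpos
  obtain ⟨v, hv, hva⟩ := X.exists_near (Nat.find hex) a
  have h1 := Nat.find_spec hex
  rw [← hv] at h1
  have hr := rad_pos (X := X) v.level
  refine ⟨v, hva, by nlinarith, ?_⟩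
  rcases Nat.eq_zero_or_eq_succ_pred v.level with h0 | h0
  · have := X.dist_lt_two_mul_scale a b
    rw [h0, rad_zero]
    nlinarith [X.scale_pos]
  · have h2 := Nat.find_min hex (m := v.level.pred) (by omega)
    have h3 := ratio_mul_rad_succ (X := X) v.level.pred
    rw [← Nat.succ_eq_add_one, ← h0] at h3
    nlinarith

theorem Represents.exists_dist_le (X : HyperbolicFilling Z) {K K' T : ℝ} (hK : 0 ≤ K)
    (hK' : 0 ≤ K') (hT : 0 ≤ T) :
    ∃ D : ℝ, ∀ (v w : X.Vertex) (a b c d : Z), Represents K v a b → Represents K' w c d →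
      PairComparable T a b c d → dist v w ≤ D := by
  obtain ⟨D, hD⟩ := X.exists_dist_le (T * K + K * T * K' + K' * T * K)
  refine ⟨D, fun v w a b c d hv hw h => hD v w a c hv.near hw.near ?_ ?_ ?_⟩
  all_goals
    have hrv := rad_pos (X := X) v.level
    have hrw := rad_pos (X := X) w.level
    have p1 : 0 ≤ T * K * X.rad v.level := by positivity
    have p2 : 0 ≤ T * K * X.rad w.level := by positivity
    have p3 : 0 ≤ K * T * K' * X.rad v.level := by positivity
    have p4 : 0 ≤ K * T * K' * X.rad w.level := by positivity
  · have := mul_le_mul_of_nonneg_left hv.dist_le hT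
    linarith [h.le_left]
  · have h1 := mul_le_mul_of_nonneg_left h.left_le hK
    have h2 := mul_le_mul_of_nonneg_left hw.dist_le (mul_nonneg hK hT)
    linarith [hv.rad_le]
  · have h1 := mul_le_mul_of_nonneg_left h.right_le hK'
    have h2 := mul_le_mul_of_nonneg_left hv.dist_le (mul_nonneg hK' hT)
    linarith [hw.rad_le]

theorem Represents.exists_pairComparable (X : HyperbolicFilling Z) {K K' : ℝ} (hK : 0 ≤ K)
    (hK' : 0 ≤ K') (k : ℕ) :
    ∃ T : ℝ, 0 ≤ T ∧ ∀ (v w : X.Vertex) (a b c d : Z), dist v w ≤ k → Represents K v a b →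
      Represents K' w c d → PairComparable T a b c d := by
  obtain ⟨C, hC, h⟩ := X.exists_of_dist_le k
  refine ⟨(1 + 2 * C) * K + (1 + C + C * C) * K' + K * C * K', by positivity,
    fun v w a b c d hvw hv hw => ?_⟩
  obtain ⟨h1, h2, h3⟩ := h v w hvw
  have n1 := hv.near
  have n2 := hw.near
  rw [Near] at n1 n2
  have tri : dist a c ≤ dist a v.center + dist v.center w.center + dist c w.center := by
    linarith [dist_triangle4 a v.center w.center c, dist_comm c w.center]
  have hab := dist_nonneg (x := a) (y := b)
  have hcd := dist_nonneg (x := c) (y := d)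
  have p1 : 0 ≤ (1 + 2 * C) * K * dist a b := by positivity
  have p2 : 0 ≤ (1 + C + C * C) * K' * dist a b := by positivity
  have p3 : 0 ≤ K * C * K' * dist a b := by positivity
  have p4 : 0 ≤ (1 + 2 * C) * K * dist c d := by positivity
  have p5 : 0 ≤ (1 + C + C * C) * K' * dist c d := by positivity
  have p6 : 0 ≤ K * C * K' * dist c d := by positivity
  have q1 := mul_le_mul_of_nonneg_left hv.rad_le (show 0 ≤ 1 + 2 * C by positivity)
  have q2 := mul_le_mul_of_nonneg_left hw.rad_le (show 0 ≤ 1 + C + C * C by positivity)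
  have q3 := mul_le_mul_of_nonneg_left h2 hC
  constructor
  · linarith
  · linarith
  · have r1 := mul_le_mul_of_nonneg_left h2 hK
    have r2 := mul_le_mul_of_nonneg_left hw.rad_le (mul_nonneg hK hC)
    linarith [hv.dist_le]
  · have r1 := mul_le_mul_of_nonneg_left h3 hK'
    have r2 := mul_le_mul_of_nonneg_left hv.rad_le (mul_nonneg hK' hC)
    linarith [hw.dist_le]

section Extension

variable {W : Type*} [MetricSpace W] {Y : HyperbolicFilling W} {K K' : ℝ}

/-- The map of vertices induced by a map that respects ratios of distances is Lipschitz. -/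
theorem exists_lipschitz_of_represents {f : Z → W} (hf : IsRatioBounded f) (hK : 0 ≤ K)
    (hK' : 0 ≤ K') {e : X.Vertex → Z} (he : ∀ v, Represents K v v.center (e v))
    {F : X.Vertex → Y.Vertex} (hF : ∀ v, Represents K' (F v) (f v.center) (f (e v))) :
    ∃ L : ℝ, ∀ v w, dist (F v) (F w) ≤ L * dist v w := by
  -- Vertices at distance at most 1 have comparable pairs, `f` keeps the pairs comparable, and
  -- comparable pairs have representatives at bounded distance.
  obtain ⟨T, hT, h₁⟩ := Represents.exists_pairComparable X hK hK 1
  obtain ⟨T', hT', h₂⟩ := hf.exists_pairComparable hT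
  obtain ⟨D, h₃⟩ := Represents.exists_dist_le Y hK' hK' hT'
  exact ⟨D, dist_map_le fun v w hvw => h₃ _ _ _ _ _ _ (hF v) (hF w) <|
    h₂ _ _ _ _ <| h₁ v w _ _ _ _ (by simpa using hvw) (he v) (he w)⟩

/-- The maps of vertices induced by mutually inverse maps are coarsely inverse. -/
theorem exists_dist_comp_le_of_represents {f : Z → W} {g : W → Z} (hgf : Function.LeftInverse g f)
    (hg : IsRatioBounded g) (hK : 0 ≤ K) (hK' : 0 ≤ K')
    {e : X.Vertex → Z} (he : ∀ v, Represents K v v.center (e v))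
    {e' : Y.Vertex → W} (he' : ∀ w, Represents K' w w.center (e' w))
    {F : X.Vertex → Y.Vertex} (hF : ∀ v, Represents K' (F v) (f v.center) (f (e v)))
    {G : Y.Vertex → X.Vertex} (hG : ∀ w, Represents K (G w) (g w.center) (g (e' w))) :
    ∃ D : ℝ, ∀ v, dist (G (F v)) v ≤ D := by
  -- The vertex `F v` represents both its own chosen pair and the image of the pair of `v`, so these
  -- are comparable. Under `g` the first becomes the pair of `G (F v)` and the second returns to the
  -- pair of `v`.
  obtain ⟨T, hT, h₁⟩ := Represents.exists_pairComparable Y hK' hK' 0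
  obtain ⟨T', hT', h₂⟩ := hg.exists_pairComparable hT
  obtain ⟨D, h₃⟩ := Represents.exists_dist_le X hK hK hT'
  refine ⟨D, fun v => h₃ _ _ _ _ _ _ (hG (F v)) (he v) ?_⟩
  have := h₂ _ _ _ _ (h₁ (F v) (F v) _ _ _ _ (by simp) (he' (F v)) (hF v))
  rwa [hgf, hgf] at this

end Extension

theorem _root_.Set.encard_le_of_forall_finset {α : Type*} {s : Set α} {N : ℕ}
    (h : ∀ A : Finset α, (A : Set α) ⊆ s → A.card ≤ N) : s.encard ≤ N := by
  by_contra! hlt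
  obtain ⟨t, hts, ht⟩ := Set.exists_subset_encard_eq (Order.add_one_le_of_lt hlt)
  have hfin : t.Finite := Set.finite_of_encard_eq_coe (k := N + 1) (by simpa using ht)
  have h1 := h hfin.toFinset (by simpa using hts)
  have h2 : ((hfin.toFinset.card : ℕ) : ℕ∞) = N + 1 := by
    rw [← ht, hfin.encard_eq_coe_toFinset_card]
  have h3 : hfin.toFinset.card = N + 1 := by exact_mod_cast h2
  omega

/-! ### Bounded geometry and disjoint clusters -/

section Regular

variable [CompactSpace Z] [Nontrivial Z] [MeasurableSpace Z] [BorelSpace Z]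

/-- Balls of fixed radius in a filling of a regular space have bounded cardinality. -/
theorem exists_encard_le (X : HyperbolicFilling Z) (hZ : IsAhlforsRegular Z) (k : ℕ) :
    ∃ N : ℕ, ∀ v : X.Vertex, {w : X.Vertex | dist v w ≤ k}.encard ≤ N := by
  classical
  obtain ⟨C, hC, h⟩ := X.exists_of_dist_le k
  set σ := min X.sep 1 with hσ
  have hσ0 : 0 < σ := lt_min X.sep_pos one_pos
  have hσ1 : σ ≤ 1 := min_le_right _ _
  obtain ⟨N, hN⟩ := hZ.exists_card_separated_le X.scale_pos (T := C * C / σ) (by positivity)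
  -- The ball meets at most `2 * k + 1` levels, and on each of them the centres form a separated set
  -- in a ball of comparable radius, of cardinality at most `N`.
  refine ⟨N * (2 * k + 1), fun v => Set.encard_le_of_forall_finset fun A hA => ?_⟩
  have himg : (A.image Vertex.level).card ≤ 2 * k + 1 := by
    calc (A.image Vertex.level).card ≤ (Finset.Icc (v.level - k) (v.level + k)).card := by
          refine Finset.card_le_card fun m hm => ?_
          obtain ⟨w, hw, rfl⟩ := Finset.mem_image.1 hm
          have h1 := (abs_level_sub_le_dist v w).trans (hA hw)
          rw [abs_le] at h1
          have h2 : v.level ≤ w.level + k := by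
            have : (v.level : ℝ) ≤ w.level + k := by linarith
            exact_mod_cast this
          have h3 : w.level ≤ v.level + k := by
            have : (w.level : ℝ) ≤ v.level + k := by linarith
            exact_mod_cast this
          rw [Finset.mem_Icc]
          omega
      _ ≤ 2 * k + 1 := by
          rw [Nat.card_Icc]
          omega
  refine (Finset.card_le_mul_card_image (f := Vertex.level) A N fun m hm => ?_).trans
    (Nat.mul_le_mul_left N himg)
  set B := {w ∈ A | w.level = m} with hB
  have hinj : Set.InjOn Vertex.center (B : Set X.Vertex) := by
    intro w hw u hu hwu
    have e1 := (Finset.mem_filter.1 (Finset.mem_coe.1 hw)).2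
    have e2 := (Finset.mem_filter.1 (Finset.mem_coe.1 hu)).2
    exact Vertex.ext (e1.trans e2.symm) hwu
  rw [← Finset.card_image_of_injOn hinj]
  have hr := rad_pos (X := X) m
  refine hN v.center (σ * X.rad m) (by positivity) ?_ _ ?_ ?_
  · exact (mul_le_of_le_one_left hr.le hσ1).trans (rad_le_scale m)
  · intro a ha
    obtain ⟨w, hw, rfl⟩ := Finset.mem_image.1 ha
    obtain ⟨hwA, hwm⟩ := Finset.mem_filter.1 hw
    obtain ⟨h1, h2, h3⟩ := h v w (hA hwA)
    rw [hwm] at h2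
    have h4 : C * C / σ * (σ * X.rad m) = C * (C * X.rad m) := by field_simp
    rw [h4, dist_comm]
    exact h1.trans (mul_le_mul_of_nonneg_left h2 hC)
  · intro a ha b hb hab
    obtain ⟨w, hw, rfl⟩ := Finset.mem_image.1 (Finset.mem_coe.1 ha)
    obtain ⟨u, hu, rfl⟩ := Finset.mem_image.1 (Finset.mem_coe.1 hb)
    have e1 := (Finset.mem_filter.1 hw).2
    have e2 := (Finset.mem_filter.1 hu).2
    refine le_trans ?_ (X.separated m (e1 ▸ w.mem) (e2 ▸ u.mem) hab)
    exact mul_le_mul_of_nonneg_right (min_le_left _ _) hr.le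

/-- Every vertex has many vertices at bounded distance that belong to it alone. -/
theorem exists_disjoint_clusters (X : HyperbolicFilling Z) (hZ : IsAhlforsRegular Z) (N : ℕ) :
    ∃ (M : ℝ) (D : X.Vertex → Set X.Vertex), (∀ v w, (D v ∩ D w).Nonempty → v = w) ∧
      (∀ v, (N : ℕ∞) ≤ (D v).encard) ∧ ∀ v, ∀ w ∈ D v, dist v w ≤ M := by
  obtain ⟨ε, hε, hcov⟩ := hZ.exists_le_card_cover X.scale_pos N
  -- The bound `sep / 4` makes open balls of radius `2 * σ * rad` about distinct centres of one
  -- level disjoint; the bound 1 keeps `σ * rad` within the scales of the covering estimate.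
  set σ := min (X.sep / 4) 1 with hσ
  have hσ0 : 0 < σ := lt_min (by linarith [X.sep_pos]) one_pos
  have hσ1 : σ ≤ 1 := min_le_right _ _
  have hσ4 : 4 * σ ≤ X.sep := by linarith [min_le_left (X.sep / 4) 1]
  have hε' : 0 < min ε 1 * σ := by positivity
  obtain ⟨k, hk⟩ := pow_unbounded_of_one_lt (min ε 1 * σ)⁻¹ X.one_lt_ratio
  obtain ⟨M, hM⟩ := X.exists_dist_le (2 + X.ratio ^ k)
  have hpow : 0 < X.ratio ^ k := pow_pos ratio_pos k
  -- Fixing the depth `k` makes the level of the owner recoverable. Covering the ball of radius `σ *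
  -- rad` takes at least `N` balls of level `v.level + k`; their radius is at most `σ * rad`, so
  -- their centres may lie up to `2 * σ * rad` away.
  refine ⟨M, fun v => {w | w.level = v.level + k ∧
    dist w.center v.center < 2 * (σ * X.rad v.level)}, ?_, ?_, ?_⟩
  · rintro v w ⟨u, ⟨h1, h2⟩, h3, h4⟩
    have hl : w.level = v.level := by omega
    refine Vertex.ext hl.symm ?_
    by_contra hne
    have h5 := X.separated v.level v.mem (hl ▸ w.mem) hne
    change X.sep * X.rad v.level ≤ _ at h5
    rw [hl] at h4
    have h6 := mul_le_mul_of_nonneg_right hσ4 (rad_pos (X := X) v.level).le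
    linarith [dist_triangle_left v.center w.center u.center]
  · intro v
    by_contra! hlt
    set S := {w : X.Vertex | w.level = v.level + k ∧
      dist w.center v.center < 2 * (σ * X.rad v.level)} with hS
    have hfin : S.Finite := Set.finite_of_encard_le_coe hlt.le
    classical
    have hrv := rad_pos (X := X) v.level
    have h1 := hcov v.center (σ * X.rad v.level) (by positivity)
      ((mul_le_of_le_one_left hrv.le hσ1).trans (rad_le_scale _))
      (hfin.toFinset.image Vertex.center) (by
        intro z hz
        obtain ⟨w, hw, hwz⟩ := X.exists_near (v.level + k) z
        have h2 := ratio_pow_mul_rad_add (X := X) v.level k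
        rw [Near, hw] at hwz
        have hrw := rad_pos (X := X) (v.level + k)
        have h3 : X.rad (v.level + k) ≤ min ε 1 * σ * X.rad v.level := by
          rw [inv_lt_iff_one_lt_mul₀ hε'] at hk
          rw [← h2]
          nlinarith
        have p : 0 ≤ σ * X.rad v.level := by positivity
        have h4 : min ε 1 * σ * X.rad v.level ≤ ε * (σ * X.rad v.level) := by
          rw [mul_assoc]
          exact mul_le_mul_of_nonneg_right (min_le_left _ _) p
        have h5 : min ε 1 * σ * X.rad v.level ≤ 1 * (σ * X.rad v.level) := by
          rw [mul_assoc]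
          exact mul_le_mul_of_nonneg_right (min_le_right _ _) p
        rw [Metric.mem_ball] at hz
        simp only [Set.mem_iUnion, exists_prop, Metric.mem_ball]
        refine ⟨w.center, Finset.mem_image_of_mem _ ?_, by linarith⟩
        rw [Set.Finite.mem_toFinset]
        exact ⟨hw, by linarith [dist_triangle_left w.center v.center z]⟩)
    have h2 := h1.trans Finset.card_image_le
    rw [hfin.encard_eq_coe_toFinset_card] at hlt
    have h3 : hfin.toFinset.card < N := by exact_mod_cast hlt
    omega
  · rintro v w ⟨hl, hd⟩
    have hrv := rad_pos (X := X) v.level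
    have hrw := rad_pos (X := X) w.level
    have h2 := ratio_pow_mul_rad_add (X := X) v.level k
    have h3 : X.rad w.level ≤ X.rad v.level := rad_strictAnti.antitone (by omega)
    rw [← hl] at h2
    refine hM v w _ _ (near_center v) (near_center w) ?_ ?_ ?_
    · rw [dist_comm]
      nlinarith
    · nlinarith
    · nlinarith

end Regular

end HyperbolicFilling

/-! ### From coarse inverses to a bilipschitz bijection -/

/-- If the fibres of `F` are no larger than the disjoint sets `D b`, then `F` can be replaced by
an injective map that sends `a` into `D (F a)`. -/
theorem exists_injective_mem_of_encard_le {α β γ : Type*} [Nonempty γ] {F : α → β}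
    {D : β → Set γ} (hD : ∀ b b', (D b ∩ D b').Nonempty → b = b') {N : ℕ}
    (hN : ∀ b, (N : ℕ∞) ≤ (D b).encard) (hF : ∀ b, (F ⁻¹' {b}).encard ≤ N) :
    ∃ φ : α → γ, Function.Injective φ ∧ ∀ a, φ a ∈ D (F a) := by
  choose g hg hinj using fun b => Set.Finite.exists_injOn_of_encard_le
    (Set.finite_of_encard_le_coe (hF b)) ((hF b).trans (hN b))
  have hmem : ∀ a, g (F a) a ∈ D (F a) := fun a => hg (F a) rfl
  refine ⟨fun a => g (F a) a, fun a a' h => ?_, hmem⟩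
  have h1 : F a = F a' := hD _ _ ⟨g (F a) a, hmem a, by
    have := hmem a'
    rwa [← show g (F a) a = g (F a') a' from h] at this⟩
  refine hinj (F a') h1 rfl ?_
  simpa [h1] using h

/-- Coarsely inverse Lipschitz maps between uniformly discrete spaces, both of which are close to
injective maps, are close to a bilipschitz bijection. -/
theorem bilipschitzEquivalent_of_coarse_inverse {X Y : Type*} [MetricSpace X] [MetricSpace Y]
    (hX : ∀ x x' : X, x ≠ x' → 1 ≤ dist x x') (hY : ∀ y y' : Y, y ≠ y' → 1 ≤ dist y y')
    {F φ : X → Y} {G ψ : Y → X} {B : ℝ} (hB : 0 ≤ B)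
    (hF : ∀ x x', dist (F x) (F x') ≤ B * dist x x')
    (hG : ∀ y y', dist (G y) (G y') ≤ B * dist y y')
    (hGF : ∀ x, dist (G (F x)) x ≤ B) (hFG : ∀ y, dist (F (G y)) y ≤ B)
    (hφ : Function.Injective φ) (hFφ : ∀ x, dist (F x) (φ x) ≤ B)
    (hψ : Function.Injective ψ) (hGψ : ∀ y, dist (G y) (ψ y) ≤ B) :
    BilipschitzEquivalent X Y := by
  -- The bijection follows `φ` or the inverse of `ψ` at each point. Both stay within `B + B * B` of
  -- `F`: for `x = ψ y`, `F x` is within `B * B` of `F (G y)`, which is within `B` of `y`.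
  obtain ⟨h, hbij, hFh⟩ := Function.Embedding.schroeder_bernstein_of_rel hφ hψ
    (fun x y => dist (F x) y ≤ B + B * B) (fun x => by nlinarith [hFφ x]) (fun y => by
      have h1 := hF (ψ y) (G y)
      have h2 := mul_le_mul_of_nonneg_left (dist_comm (G y) (ψ y) ▸ hGψ y) hB
      linarith [dist_triangle (F (ψ y)) (F (G y)) y, hFG y])
  set E := B + B * B with hE
  have hE0 : 0 ≤ E := by positivity
  refine ⟨h, hbij, 4 * B + 2 * E + 2 * B * E + 1, by positivity, fun x x' => ?_⟩
  rcases eq_or_ne x x' with rfl | hne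
  · simp
  -- Distances at least 1 allow the additive errors below to be absorbed into the multiplicative
  -- constant.
  have d1 := hX x x' hne
  have d2 := hY _ _ (hbij.injective.ne hne)
  have up : dist (h x) (h x') ≤ B * dist x x' + 2 * E := by
    linarith [dist_triangle4 (h x) (F x) (F x') (h x'), hF x x', hFh x, hFh x',
      dist_comm (h x) (F x)]
  have mid : dist (F x) (F x') ≤ dist (h x) (h x') + 2 * E := by
    linarith [dist_triangle4 (F x) (h x) (h x') (F x'), hFh x, hFh x', dist_comm (h x') (F x')]
  have low : dist x x' ≤ B * (dist (h x) (h x') + 2 * E) + 2 * B := by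
    have := mul_le_mul_of_nonneg_left mid hB
    linarith [dist_triangle4 x (G (F x)) (G (F x')) x', hG (F x) (F x'), hGF x, hGF x',
      dist_comm x (G (F x))]
  have hBE : 0 ≤ B * E := by positivity
  constructor
  · rw [one_div, inv_mul_le_iff₀ (by positivity)]
    nlinarith
  · nlinarith

namespace HyperbolicFilling

variable {Z W : Type*} [MetricSpace Z] [MetricSpace W]

/-- Two points of a fibre of `F` have the same image under `G ∘ F`, which moves points by at most
`D`; so fibres have diameter at most `2 * D` and bounded cardinality, and they fit into the clusters
of `Y`. -/
theorem exists_injective_near [CompactSpace Z] [Nontrivial Z] [MeasurableSpace Z] [BorelSpace Z]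
    [CompactSpace W] [Nontrivial W] [MeasurableSpace W] [BorelSpace W]
    (hZ : IsAhlforsRegular Z) (hW : IsAhlforsRegular W) {X : HyperbolicFilling Z}
    {Y : HyperbolicFilling W} {F : X.Vertex → Y.Vertex} {G : Y.Vertex → X.Vertex} {D : ℝ}
    (hGF : ∀ v, dist (G (F v)) v ≤ D) :
    ∃ (M : ℝ) (φ : X.Vertex → Y.Vertex), Function.Injective φ ∧ ∀ v, dist (F v) (φ v) ≤ M := by
  obtain ⟨k, hk⟩ := exists_nat_ge (2 * D)
  obtain ⟨N, hN⟩ := X.exists_encard_le hZ k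
  obtain ⟨M, S, hS, hSN, hM⟩ := Y.exists_disjoint_clusters hW N
  have : Nonempty Y.Vertex := Y.graph_connected.nonempty
  obtain ⟨φ, hφ, h⟩ := exists_injective_mem_of_encard_le (F := F) hS hSN (fun w => by
    rcases (F ⁻¹' {w}).eq_empty_or_nonempty with h0 | ⟨v, hv⟩
    · simp [h0]
    · refine (Set.encard_le_encard fun u hu => ?_).trans (hN v)
      have e : F u = F v := Eq.trans hu (Eq.symm hv)
      have h1 := hGF u
      rw [e] at h1
      exact (by linarith [dist_triangle_left v u (G (F v)), hGF v] : dist v u ≤ 2 * D).trans hk)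
  exact ⟨M, φ, hφ, fun v => hM _ _ (h v)⟩

theorem bilipschitzEquivalent_of_isRatioBounded
    [CompactSpace Z] [Nontrivial Z] [MeasurableSpace Z] [BorelSpace Z]
    [CompactSpace W] [Nontrivial W] [MeasurableSpace W] [BorelSpace W]
    (hZ : IsAhlforsRegular Z) (hW : IsAhlforsRegular W) (f : Z ≃ W) (hf : IsRatioBounded f)
    (hf' : IsRatioBounded f.symm) (X : HyperbolicFilling Z) (Y : HyperbolicFilling W) :
    BilipschitzEquivalent X.Vertex Y.Vertex := by
  obtain ⟨K₁, e, hK₁, he⟩ := X.exists_represents_center hZ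
  obtain ⟨K₂, e', hK₂, he'⟩ := Y.exists_represents_center hW
  obtain ⟨K₃, hK₃, hX⟩ := X.exists_represents
  obtain ⟨K₄, hK₄, hY⟩ := Y.exists_represents
  choose F hF using fun v => hY (f v.center) (f (e v)) (f.injective.ne (he v).ne)
  choose G hG using fun w => hX (f.symm w.center) (f.symm (e' w)) (f.symm.injective.ne (he' w).ne)
  replace he := fun v => (he v).mono (le_max_left K₁ K₃)
  replace hG := fun w => (hG w).mono (le_max_right K₁ K₃)
  replace he' := fun w => (he' w).mono (le_max_left K₂ K₄)
  replace hF := fun v => (hF v).mono (le_max_right K₂ K₄)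
  have hK : 0 ≤ max K₁ K₃ := hK₁.trans (le_max_left _ _)
  have hK' : 0 ≤ max K₂ K₄ := hK₂.trans (le_max_left _ _)
  obtain ⟨L₁, hL₁⟩ := exists_lipschitz_of_represents hf hK hK' he hF
  obtain ⟨L₂, hL₂⟩ := exists_lipschitz_of_represents hf' hK' hK he' hG
  obtain ⟨D₁, hD₁⟩ := exists_dist_comp_le_of_represents f.left_inv hf' hK hK' he he' hF hG
  obtain ⟨D₂, hD₂⟩ := exists_dist_comp_le_of_represents f.right_inv hf hK' hK he' he hG hF
  obtain ⟨M₁, φ, hφ, hM₁⟩ := exists_injective_near hZ hW hD₁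
  obtain ⟨M₂, ψ, hψ, hM₂⟩ := exists_injective_near hW hZ hD₂
  obtain ⟨B, hB⟩ := (Set.toFinite {0, L₁, L₂, D₁, D₂, M₁, M₂}).bddAbove
  simp only [mem_upperBounds, Set.mem_insert_iff, Set.mem_singleton_iff, forall_eq_or_imp,
    forall_eq] at hB
  obtain ⟨h0, h1, h2, h3, h4, h5, h6⟩ := hB
  exact bilipschitzEquivalent_of_coarse_inverse (fun _ _ => one_le_dist) (fun _ _ => one_le_dist)
    h0 (fun v w => (hL₁ v w).trans (mul_le_mul_of_nonneg_right h1 dist_nonneg))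
    (fun v w => (hL₂ v w).trans (mul_le_mul_of_nonneg_right h2 dist_nonneg))
    (fun v => (hD₁ v).trans h3) (fun w => (hD₂ w).trans h4)
    hφ (fun v => (hM₁ v).trans h5) hψ (fun w => (hM₂ w).trans h6)

/-! ### One-point spaces -/

/-- Over a one-point space every level has exactly one vertex, so the fillings are rays and matching
levels is the natural map. -/
theorem exists_level_map [Subsingleton Z] [Subsingleton W] (X : HyperbolicFilling Z)
    (Y : HyperbolicFilling W) :
    ∃ F : X.Vertex → Y.Vertex, (∀ v, (F v).level = v.level) ∧ Function.Injective F ∧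
      ∀ v w, dist (F v) (F w) ≤ 2 * dist v w := by
  obtain ⟨q, -⟩ := Y.net_zero
  choose F hF hFq using fun v : X.Vertex => Y.exists_near v.level q
  refine ⟨F, hF, fun v w h => Vertex.ext (by rw [← hF v, ← hF w, h]) (Subsingleton.elim _ _),
    dist_map_le fun v w hvw => ?_⟩
  have h1 := (abs_level_sub_le_dist v w).trans hvw
  rw [abs_le] at h1
  have h2 : v.level ≤ w.level + 1 := by
    have : (v.level : ℝ) ≤ w.level + 1 := by linarith
    exact_mod_cast this
  have h3 : w.level ≤ v.level + 1 := by
    have : (w.level : ℝ) ≤ v.level + 1 := by linarith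
    exact_mod_cast this
  rcases le_total v.level w.level with hl | hl
  · obtain ⟨k, hk⟩ := Nat.exists_eq_add_of_le hl
    have h4 := dist_le_of_near k (hFq v) (hFq w) (by rw [hF, hF, hk])
    have h5 : (k : ℝ) ≤ 1 := by exact_mod_cast (by omega : k ≤ 1)
    linarith
  · obtain ⟨k, hk⟩ := Nat.exists_eq_add_of_le hl
    have h4 := dist_le_of_near k (hFq w) (hFq v) (by rw [hF, hF, hk])
    have h5 : (k : ℝ) ≤ 1 := by exact_mod_cast (by omega : k ≤ 1)
    rw [dist_comm] at h4
    linarith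

theorem bilipschitzEquivalent_of_subsingleton [Subsingleton Z] [Subsingleton W]
    (X : HyperbolicFilling Z) (Y : HyperbolicFilling W) :
    BilipschitzEquivalent X.Vertex Y.Vertex := by
  obtain ⟨F, hF, hFi, hFL⟩ := exists_level_map X Y
  obtain ⟨G, hG, hGi, hGL⟩ := exists_level_map Y X
  have hGF : ∀ v, G (F v) = v := fun v =>
    Vertex.ext ((hG _).trans (hF v)) (Subsingleton.elim _ _)
  have hFG : ∀ w, F (G w) = w := fun w =>
    Vertex.ext ((hF _).trans (hG w)) (Subsingleton.elim _ _)
  exact bilipschitzEquivalent_of_coarse_inverse (fun _ _ => one_le_dist) (fun _ _ => one_le_dist)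
    (B := 2) (by norm_num) hFL hGL (fun v => by simp [hGF]) (fun w => by simp [hFG])
    hFi (fun v => by simp) hGi (fun w => by simp)

end HyperbolicFilling

theorem bilipschitzEquivalent_of_equiv {Z W : Type*}
    [MetricSpace Z] [CompactSpace Z] [MeasurableSpace Z] [BorelSpace Z]
    [MetricSpace W] [CompactSpace W] [MeasurableSpace W] [BorelSpace W]
    (hZ : IsAhlforsRegular Z) (hW : IsAhlforsRegular W) (f : Z ≃ W) (hf : IsRatioBounded f)
    (hf' : IsRatioBounded f.symm) (X : HyperbolicFilling Z) (Y : HyperbolicFilling W) :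
    BilipschitzEquivalent X.Vertex Y.Vertex := by
  -- A one-point space has no pairs of distinct points to represent vertices, so it is treated
  -- apart.
  rcases subsingleton_or_nontrivial Z with hs | hs
  · have := f.symm.subsingleton
    exact HyperbolicFilling.bilipschitzEquivalent_of_subsingleton X Y
  · have := f.symm.nontrivial
    exact HyperbolicFilling.bilipschitzEquivalent_of_isRatioBounded hZ hW f hf hf' X Y

theorem corollary2 {Z W : Type*}
    [MetricSpace Z] [CompactSpace Z] [MeasurableSpace Z] [BorelSpace Z]
    [MetricSpace W] [CompactSpace W] [MeasurableSpace W] [BorelSpace W]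
    (hZ : IsAhlforsRegular Z) (hW : IsAhlforsRegular W) :
    (QuasisymmetricallyEquivalent Z W →
      ∀ (X : HyperbolicFilling Z) (Y : HyperbolicFilling W),
        BilipschitzEquivalent X.Vertex Y.Vertex) ∧
    (∀ X X' : HyperbolicFilling Z, BilipschitzEquivalent X.Vertex X'.Vertex) := by
  refine ⟨?_, fun X X' => ?_⟩
  · rintro ⟨f, hf⟩ X Y
    exact bilipschitzEquivalent_of_equiv hZ hW f.toEquiv hf.isRatioBounded
      hf.isRatioBounded_symm X Y
  · exact bilipschitzEquivalent_of_equiv hZ hZ (Equiv.refl Z) isRatioBounded_id isRatioBounded_id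
      X X'
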